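/- \textbf{Setting.} An \emph{effectus in partial form} is a category $\mathbf{C}$ with finite coproducts, with a partial commutative monoid structure $(\ovee, 0)$ on each homset that is preserved by pre- and post-composition, and with a special object $I$, such that: (a) for all $b\colon X\to Y+Y$ the maps $[\mathrm{id},0]\circ b$ and $[0,\mathrm{id}]\circ b$ are orthogonal (their sum $\ovee$ is defined); (b) if $f\perp g$ then $\kappa_1\circ f\perp\kappa_2\circ g$; (c) each homset $\mathrm{Pred}(X)=\mathbf{C}(X,I)$ of \emph{predicates} is an effect algebra, with orthosupplement $p^\perp$, bottom $\mathbf 0$, top $\mathbf 1$, and order $p\le q$ iff $p\ovee r=q$ for some $r$; (d) $\mathbf 1\circ f\perp\mathbf 1\circ g$ implies $f\perp g$, and $\mathbf 1\circ f=\mathbf 0$ implies $f=0$. A map $f$ is \emph{total} if $\mathbf 1\circ f=\mathbf 1$. A predicate $p$ is \emph{sharp} if $q\le p$ and $q\le p^\perp$ imply $q=\mathbf 0$; $\mathrm{ShaPred}(X)\subseteq\mathrm{Pred}(X)$ is the subposet of sharp predicates. For $f\colon X\to Y$ and $q\in\mathrm{Pred}(Y)$ put $f^{\Box}(q)=(q^\perp\circ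 f)^\perp$. The category $\mathrm{Pred}_\Box(\mathbf C)$ has as objects the pairs $(X,p)$ with $p\in\mathrm{Pred}(X)$ and as maps $(X,p)\to(Y,q)$ the maps $f\colon X\to Y$ with $p\le f^\Box(q)$. \emph{Comprehension} is a right adjoint $(X,p)\mapsto\{X|p\}$ to the functor $X\mapsto(X,\mathbf 1)$, with counit maps $\pi_p\colon\{X|p\}\to X$ (the \emph{comprehension maps}) that are total; \emph{quotients} are a left adjoint $(X,p)\mapsto X/p$ to the functor $X\mapsto(X,\mathbf 0)$, with unit maps $\xi_p\colon X\to X/p$. The \emph{image} $\mathrm{im}(f)$ of $f\colon X\to Y$ is the least $q\in\mathrm{Pred}(Y)$ with $f^\Box(q)=\mathbf 1$; $f$ is an \emph{internal epi} if $\mathrm{im}(f)=\mathbf 1$. \textbf{Proposition.} Let $\mathbf{C}$ be an effectus in partial form which has comprehension and quotients such that $\theta_p=\xi_{p^\perp}\circ\pi_p\colon\{X|p\}\to X/p^\perp$ is an isomorphism for every sharp predicate $p$. Assume that all maps have images and that images are sharp, and that for all sharp predicates $p,q$ on the same object one has $p\le q$ if and only if $\pi_p$ factors through $\pi_q$. For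 sharp $p$ write $\mathrm{asrt}_p=\pi_p\circ\theta_p^{-1}\circ\xi_{p^\perp}$. Then: \begin{enumerate} \item For each predicate $p$, $\lfloor p\rfloor:=\mathrm{im}(\pi_p)$ is the greatest sharp predicate below $p$, and $\lceil p\rceil:=\lfloor p^\perp\rfloor^\perp$ is the least sharp predicate above $p$. \item Let $p\in\mathrm{Pred}(X)$. For each total map $f\colon Y\to X$: $p\circ f=\mathbf 1$ iff $\lfloor p\rfloor\circ f=\mathbf 1$, and $p\circ f=\mathbf 0$ iff $\lceil p\rceil\circ f=\mathbf 0$. For each map $g\colon Y\to X$: $g^\Box(p)=\mathbf 1$ iff $g^\Box(\lfloor p\rfloor)=\mathbf 1$. \item For each sharp predicate $p$ on $X$: $\mathrm{im}(\mathrm{asrt}_p)=p$, and $\xi_p\colon X\to X/p$ is a cokernel of $\mathrm{asrt}_p$, that is, a coequaliser of $\mathrm{asrt}_p,0\colon X\to X$. \item For $f\colon X\to Y$ put $\Sigma_f(p)=\mathrm{im}(f\circ\pi_p)$. Then $\Sigma_f\colon\mathrm{ShaPred}(X)\to\mathrm{ShaPred}(Y)$ is left adjoint to $\lfloor f^\Box(-)\rfloor\colon\mathrm{ShaPred}(Y)\to\mathrm{ShaPred}(X)$: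 for sharp $p,q$, $\Sigma_f(p)\le q$ iff $p\le\lfloor f^\Box(q)\rfloor$. \item Comprehension maps are closed under composition, up to isomorphism: for $p\in\mathrm{Pred}(X)$ and $q\in\mathrm{Pred}(\{X|p\})$ there is an isomorphism $e\colon\{\{X|p\}|q\}\cong\{X|\Sigma_{\pi_p}(q)\}$ with $\pi_{\Sigma_{\pi_p}(q)}\circ e=\pi_p\circ\pi_q$. \item Each poset $\mathrm{ShaPred}(X)$, with orthocomplement $(-)^\perp$, is an orthomodular lattice. \item The internal epis and the comprehension maps (the maps isomorphic to some $\pi_p$) form a factorisation system in $\mathbf C$: both classes contain all isomorphisms and are closed under composition, a map in both classes is an isomorphism, every map is an internal epi followed by a comprehension map, and every commuting square from an internal epi to a comprehension map has a unique diagonal fill-in. \end{enumerate} -/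

import Mathlib

open CategoryTheory CategoryTheory.Limits

universe v u w

namespace EffectusTheory

/-- Partial commutative monoids. The partial sum `x ⊕ y` is defined, with value `z`, when
`ovee x y = some z`. -/
class PCM (M : Type w) extends Zero M where
  ovee : M → M → Option M
  ovee_zero : ∀ x, ovee x 0 = some x
  ovee_comm : ∀ x y, ovee x y = ovee y x
  ovee_assoc : ∀ {x y z s t}, ovee x y = some s → ovee s z = some t →
    ∃ r, ovee y z = some r ∧ ovee x r = some t

/-- Orthogonality: the partial sum is defined. -/
def Orth {M : Type w} [PCM M] (x y : M) : Prop := ∃ z, PCM.ovee x y = some z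

/-- The structure of an effect algebra on a partial commutative monoid: `xᶜ` is the
orthosupplement of `x`, and the unit element is `0ᶜ`. -/
class EffectAlgebra (M : Type w) [PCM M] extends Compl M where
  ovee_compl : ∀ x : M, PCM.ovee x xᶜ = some (0 : M)ᶜ
  compl_unique : ∀ x y : M, PCM.ovee x y = some (0 : M)ᶜ → y = xᶜ
  eq_zero_of_orth_one : ∀ x : M, Orth x (0 : M)ᶜ → x = 0

namespace EffectAlgebra

section

variable {M : Type w} [PCM M]

/-- The order of an effect algebra. -/
def le (x y : M) : Prop := ∃ z, PCM.ovee x z = some y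

theorem le_refl' (x : M) : le x x := ⟨0, PCM.ovee_zero x⟩

theorem le_trans' {x y z : M} (h : le x y) (k : le y z) : le x z := by
  obtain ⟨a, ha⟩ := h
  obtain ⟨b, hb⟩ := k
  obtain ⟨r, _, hr⟩ := PCM.ovee_assoc ha hb
  exact ⟨r, hr⟩

theorem zero_le' (x : M) : le 0 x := ⟨x, by rw [PCM.ovee_comm]; exact PCM.ovee_zero x⟩

end

variable {M : Type w} [PCM M] [EffectAlgebra M]

theorem compl_compl' (x : M) : xᶜᶜ = x :=
  (compl_unique xᶜ x (by rw [PCM.ovee_comm]; exact ovee_compl x)).symm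

theorem le_antisymm' {x y : M} (h : le x y) (k : le y x) : x = y := by
  obtain ⟨a, ha⟩ := h
  obtain ⟨b, hb⟩ := k
  obtain ⟨r, hr, hyr⟩ := PCM.ovee_assoc hb (ovee_compl x)
  obtain ⟨s, hs, hxs⟩ := PCM.ovee_assoc ha hyr
  have hsx : s = xᶜ := compl_unique _ _ hxs
  subst hsx
  obtain ⟨t, ht, _⟩ := PCM.ovee_assoc hs (by rw [PCM.ovee_comm]; exact ovee_compl x)
  obtain ⟨c, hc, hbc⟩ := PCM.ovee_assoc hr ht
  rw [PCM.ovee_comm, ovee_compl] at hc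
  cases hc
  have hb0 : b = 0 := eq_zero_of_orth_one b ⟨_, hbc⟩
  subst hb0
  rw [PCM.ovee_zero] at hb
  exact (Option.some.inj hb).symm

theorem compl_le_compl' {x y : M} (h : le x y) : le yᶜ xᶜ := by
  obtain ⟨a, ha⟩ := h
  obtain ⟨r, hr, hxr⟩ := PCM.ovee_assoc ha (ovee_compl y)
  have h' := compl_unique _ _ hxr
  subst h'
  exact ⟨a, by rw [PCM.ovee_comm]; exact hr⟩

theorem le_one' (x : M) : le x (0 : M)ᶜ := ⟨xᶜ, ovee_compl x⟩

end EffectAlgebra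

/-- Finitely partially additive categories: categories with finite coproducts, enriched over
partial commutative monoids, that satisfy the compatible sum axiom and the untying axiom. -/
class FinPAC (C : Type u) [Category.{v} C] [HasFiniteCoproducts C] where
  [homPCM : ∀ X Y : C, PCM (X ⟶ Y)]
  zero_comp : ∀ {X Y Z : C} (g : Y ⟶ Z), (0 : X ⟶ Y) ≫ g = 0
  comp_zero : ∀ {X Y Z : C} (f : X ⟶ Y), f ≫ (0 : Y ⟶ Z) = 0
  ovee_comp : ∀ {X Y Z : C} {f₁ f₂ s : X ⟶ Y} (g : Y ⟶ Z),
    PCM.ovee f₁ f₂ = some s → PCM.ovee (f₁ ≫ g) (f₂ ≫ g) = some (s ≫ g)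
  comp_ovee : ∀ {X Y Z : C} (f : X ⟶ Y) {g₁ g₂ s : Y ⟶ Z},
    PCM.ovee g₁ g₂ = some s → PCM.ovee (f ≫ g₁) (f ≫ g₂) = some (f ≫ s)
  compatible_sum : ∀ {X Y : C} (b : X ⟶ Y ⨿ Y),
    Orth (b ≫ coprod.desc (𝟙 Y) 0) (b ≫ coprod.desc 0 (𝟙 Y))
  untying : ∀ {X Y : C} (f g : X ⟶ Y), Orth f g →
    Orth (f ≫ (coprod.inl : Y ⟶ Y ⨿ Y)) (g ≫ (coprod.inr : Y ⟶ Y ⨿ Y))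

attribute [reducible, instance] FinPAC.homPCM

/-- Effectuses in partial form (finitely partially additive categories with effects). The
predicates on `X` are the morphisms `X ⟶ I`. -/
class Effectus (C : Type u) [Category.{v} C] [HasFiniteCoproducts C] extends FinPAC C where
  I : C
  [predEA : ∀ X : C, EffectAlgebra (X ⟶ I)]
  orth_of_truth_orth : ∀ {X Y : C} (f g : Y ⟶ X),
    Orth (f ≫ (0 : X ⟶ I)ᶜ) (g ≫ (0 : X ⟶ I)ᶜ) → Orth f g
  eq_zero_of_truth_eq_zero : ∀ {X Y : C} (f : Y ⟶ X), f ≫ (0 : X ⟶ I)ᶜ = 0 → f = 0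

attribute [reducible, instance] Effectus.predEA

section

variable {C : Type u} [Category.{v} C] [HasFiniteCoproducts C] [Effectus C]

/-- Predicates on an object. -/
abbrev Pred (X : C) : Type v := X ⟶ (Effectus.I : C)

instance (X : C) : PartialOrder (Pred X) where
  le := EffectAlgebra.le
  le_refl := EffectAlgebra.le_refl'
  le_trans _ _ _ := EffectAlgebra.le_trans'
  le_antisymm _ _ := EffectAlgebra.le_antisymm'

/-- The truth predicate. -/
def truth (X : C) : Pred X := (0 : Pred X)ᶜ

/-- The falsity predicate. -/
def falsity (X : C) : Pred X := 0

/-- Total maps. -/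
def IsTotalMap {X Y : C} (f : X ⟶ Y) : Prop := f ≫ truth Y = truth X

/-- Partial substitution `f^□`. -/
def box {X Y : C} (f : X ⟶ Y) (q : Pred Y) : Pred X := (f ≫ qᶜ)ᶜ

/-- Sharp predicates. -/
def IsSharp {X : C} (p : Pred X) : Prop := ∀ q : Pred X, q ≤ p → q ≤ pᶜ → q = falsity X

theorem IsSharp.compl {X : C} {p : Pred X} (hp : IsSharp p) : IsSharp pᶜ := by
  intro q h₁ h₂
  rw [EffectAlgebra.compl_compl'] at h₂
  exact hp q h₂ h₁

theorem box_id {X : C} (q : Pred X) : box (𝟙 X) q = q := by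
  simp [box, EffectAlgebra.compl_compl']

theorem box_comp {X Y Z : C} (f : X ⟶ Y) (g : Y ⟶ Z) (q : Pred Z) :
    box (f ≫ g) q = box f (box g q) := by
  simp [box, EffectAlgebra.compl_compl']

theorem box_mono {X Y : C} (f : X ⟶ Y) {q r : Pred Y} (h : q ≤ r) : box f q ≤ box f r := by
  obtain ⟨a, ha⟩ := EffectAlgebra.compl_le_compl' h
  exact EffectAlgebra.compl_le_compl' ⟨f ≫ a, FinPAC.comp_ovee f ha⟩

theorem box_truth {X Y : C} (f : X ⟶ Y) : box f (truth Y) = truth X := by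
  simp [box, truth, EffectAlgebra.compl_compl', FinPAC.comp_zero]

/-- The poset of sharp predicates on `X`, as a subposet of the predicates. -/
abbrev ShaPred (X : C) : Type v := {p : Pred X // IsSharp p}

/-- Orthosupplement of sharp predicates. -/
def shaCompl {X : C} (p : ShaPred X) : ShaPred X := ⟨p.1ᶜ, p.2.compl⟩

end

/-- Objects of the category `Pred_□(C)`: an object of `C` with a predicate on it. -/
structure PredBox (C : Type u) [Category.{v} C] [HasFiniteCoproducts C] [Effectus C] where
  carrier : C
  pred : Pred carrier

section

variable (C : Type u) [Category.{v} C] [HasFiniteCoproducts C] [Effectus C]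

/-- A morphism `(X, p) ⟶ (Y, q)` is a morphism `f : X ⟶ Y` with `p ≤ f^□(q)`. -/
instance : Category.{v} (PredBox C) where
  Hom A B := {f : A.carrier ⟶ B.carrier // A.pred ≤ box f B.pred}
  id A := ⟨𝟙 A.carrier, by rw [box_id]⟩
  comp f g := ⟨f.1 ≫ g.1, by
    rw [box_comp]
    exact le_trans f.2 (box_mono f.1 g.2)⟩
  id_comp f := Subtype.ext (Category.id_comp f.1)
  comp_id f := Subtype.ext (Category.comp_id f.1)
  assoc f g h := Subtype.ext (Category.assoc f.1 g.1 h.1)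

/-- The truth functor `X ↦ (X, 1)`. -/
def truthFunctor : C ⥤ PredBox C where
  obj X := ⟨X, truth X⟩
  map f := ⟨f, (box_truth f).ge⟩
  map_id _ := rfl
  map_comp _ _ := rfl

/-- The falsity functor `X ↦ (X, 0)`. -/
def falsityFunctor : C ⥤ PredBox C where
  obj X := ⟨X, falsity X⟩
  map f := ⟨f, EffectAlgebra.zero_le' _⟩
  map_id _ := rfl
  map_comp _ _ := rfl

/-- Comprehension: a right adjoint of the truth functor, with total counit components. -/
structure Comprehension where
  cmpr : PredBox C ⥤ C
  adj : truthFunctor C ⊣ cmpr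
  total_counit : ∀ A : PredBox C, IsTotalMap (adj.counit.app A).1

/-- Quotients: a left adjoint of the falsity functor. -/
structure Quotients where
  quot : PredBox C ⥤ C
  adj : quot ⊣ falsityFunctor C

end

section

variable {C : Type u} [Category.{v} C] [HasFiniteCoproducts C] [Effectus C]

/-- The object `{X | p}`. -/
abbrev Comprehension.obj (K : Comprehension C) {X : C} (p : Pred X) : C := K.cmpr.obj ⟨X, p⟩

/-- The comprehension map `π_p : {X | p} ⟶ X`. -/
def Comprehension.π (K : Comprehension C) {X : C} (p : Pred X) : K.obj p ⟶ X :=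
  (K.adj.counit.app ⟨X, p⟩).1

/-- The object `X / p`. -/
abbrev Quotients.obj (Q : Quotients C) {X : C} (p : Pred X) : C := Q.quot.obj ⟨X, p⟩

/-- The quotient map `ξ_p : X ⟶ X / p`. -/
def Quotients.ξ (Q : Quotients C) {X : C} (p : Pred X) : X ⟶ Q.obj p :=
  (Q.adj.unit.app ⟨X, p⟩).1

/-- The canonical map `θ_p : {X | p} ⟶ X / pᗮ`. -/
def theta (K : Comprehension C) (Q : Quotients C) {X : C} (p : Pred X) : K.obj p ⟶ Q.obj pᶜ :=
  K.π p ≫ Q.ξ pᶜ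

end

/-- Both quotients and comprehension: `θ_p` is an isomorphism for each sharp predicate `p`. -/
structure QuotientsAndComprehension (C : Type u) [Category.{v} C] [HasFiniteCoproducts C]
    [Effectus C] where
  K : Comprehension C
  Q : Quotients C
  isIso_theta : ∀ {X : C} (p : Pred X), IsSharp p → IsIso (theta K Q p)

/-- Images: for each `f : X ⟶ Y` there is a least predicate `q` on `Y` with `f^□(q) = 1`. -/
class HasImagePredicates (C : Type u) [Category.{v} C] [HasFiniteCoproducts C] [Effectus C] :
    Prop where
  exists_image : ∀ {X Y : C} (f : X ⟶ Y), ∃ q : Pred Y, IsLeast {q | box f q = truth X} q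

section

variable {C : Type u} [Category.{v} C] [HasFiniteCoproducts C] [Effectus C]

/-- The image predicate `im(f)`. -/
noncomputable def img [HasImagePredicates C] {X Y : C} (f : X ⟶ Y) : Pred Y :=
  (HasImagePredicates.exists_image f).choose

end

/-- Sharp images. -/
class HasSharpImages (C : Type u) [Category.{v} C] [HasFiniteCoproducts C] [Effectus C] : Prop
    extends HasImagePredicates C where
  sharp_img : ∀ {X Y : C} (f : X ⟶ Y), IsSharp (img f)

namespace QuotientsAndComprehension

variable {C : Type u} [Category.{v} C] [HasFiniteCoproducts C] [Effectus C]
variable (S : QuotientsAndComprehension C)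

/-- The object `{X | p}`. -/
abbrev cmpr {X : C} (p : Pred X) : C := S.K.obj p

/-- The comprehension map `π_p : {X | p} ⟶ X`. -/
abbrev π {X : C} (p : Pred X) : S.cmpr p ⟶ X := S.K.π p

/-- The object `X / p`. -/
abbrev quot {X : C} (p : Pred X) : C := S.Q.obj p

/-- The quotient map `ξ_p : X ⟶ X / p`. -/
abbrev ξ {X : C} (p : Pred X) : X ⟶ S.quot p := S.Q.ξ p

/-- The map `asrt_p = π_p ∘ θ_p⁻¹ ∘ ξ_{pᗮ}` of a sharp predicate `p`. -/
noncomputable def asrt {X : C} (p : Pred X) (hp : IsSharp p) : X ⟶ X :=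
  haveI := S.isIso_theta p hp
  S.ξ pᶜ ≫ inv (theta S.K S.Q p) ≫ S.π p

/-- For sharp predicates, `p ≤ q` if and only if `π_p` factors through `π_q`. -/
def OrderByFactorisation : Prop :=
  ∀ {X : C} (p q : Pred X), IsSharp p → IsSharp q →
    (p ≤ q ↔ ∃ h : S.cmpr p ⟶ S.cmpr q, h ≫ S.π q = S.π p)

section

variable [HasImagePredicates C]

/-- `⌊p⌋ = im(π_p)`. -/
noncomputable def floor {X : C} (p : Pred X) : Pred X := img (S.π p)

/-- `⌈p⌉ = ⌊pᗮ⌋ᗮ`. -/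
noncomputable def ceil {X : C} (p : Pred X) : Pred X := (S.floor pᶜ)ᶜ

/-- `Σ_f(p) = im(f ∘ π_p)`. -/
noncomputable def sigma {X Y : C} (f : X ⟶ Y) (p : Pred X) : Pred Y := img (S.π p ≫ f)

end

/-- `Σ_f` on sharp predicates. -/
noncomputable def shaSigma [HasSharpImages C] {X Y : C} (f : X ⟶ Y) (p : ShaPred X) :
    ShaPred Y :=
  ⟨S.sigma f p.1, HasSharpImages.sharp_img _⟩

/-- `⌊f^□(-)⌋` on sharp predicates. -/
noncomputable def shaBox [HasSharpImages C] {X Y : C} (f : X ⟶ Y) (q : ShaPred Y) :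
    ShaPred X :=
  ⟨S.floor (box f q.1), HasSharpImages.sharp_img _⟩

/-- The class of comprehension maps, closed under isomorphisms. -/
def comprehensionMaps : MorphismProperty C := fun X Y f =>
  ∃ (p : Pred Y) (e : X ≅ S.cmpr p), e.hom ≫ S.π p = f

end QuotientsAndComprehension

/-- The class of internal epis: the maps `f` with `im(f) = 1`. -/
def internalEpis (C : Type u) [Category.{v} C] [HasFiniteCoproducts C] [Effectus C]
    [HasImagePredicates C] : MorphismProperty C := fun _ Y f => img f = truth Y

/-- `P` is an orthomodular lattice with orthocomplement `c`. -/
structure IsOrthomodularLattice (P : Type w) [PartialOrder P] (c : P → P) : Prop where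
  exists_bot : ∃ b : P, IsLeast Set.univ b
  exists_top : ∃ t : P, IsGreatest Set.univ t
  exists_inf : ∀ x y : P, ∃ m, IsGLB {x, y} m
  exists_sup : ∀ x y : P, ∃ j, IsLUB {x, y} j
  compl_compl : ∀ x, c (c x) = x
  compl_anti : ∀ x y, x ≤ y → c y ≤ c x
  inf_compl : ∀ x b, IsLeast Set.univ b → IsGLB {x, c x} b
  sup_compl : ∀ x t, IsGreatest Set.univ t → IsLUB {x, c x} t
  orthomodular : ∀ x y m, x ≤ y → IsGLB {c x, y} m → IsLUB {x, m} y

/-- `(E, M)` is an (orthogonal) factorisation system: both classes contain the isomorphisms and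
are closed under composition, their intersection consists of the isomorphisms, each morphism
factors as an `E` followed by an `M`, and there are unique diagonal fill-ins. -/
structure IsFactorisationSystem {C : Type u} [Category.{v} C] (E M : MorphismProperty C) :
    Prop where
  iso_left : ∀ {X Y : C} (f : X ⟶ Y), IsIso f → E f
  iso_right : ∀ {X Y : C} (f : X ⟶ Y), IsIso f → M f
  comp_left : ∀ {X Y Z : C} (f : X ⟶ Y) (g : Y ⟶ Z), E f → E g → E (f ≫ g)
  comp_right : ∀ {X Y Z : C} (f : X ⟶ Y) (g : Y ⟶ Z), M f → M g → M (f ≫ g)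
  isIso_of_both : ∀ {X Y : C} (f : X ⟶ Y), E f → M f → IsIso f
  factor : ∀ {X Y : C} (f : X ⟶ Y), ∃ (Z : C) (e : X ⟶ Z) (m : Z ⟶ Y),
    E e ∧ M m ∧ e ≫ m = f
  fill_in : ∀ {A B X Y : C} (e : A ⟶ B) (m : X ⟶ Y) (g : A ⟶ X) (h : B ⟶ Y),
    E e → M m → e ≫ h = g ≫ m → ∃! d : B ⟶ X, e ≫ d = g ∧ d ≫ m = h

end EffectusTheory

open EffectusTheory

/-! Everything is reduced to equations `f ≫ pᶜ = 0`. Such an equation says at once that `f^□(p) =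
1`, that `img f ≤ p`, and that `f` factors through `π_p`. Taking `f = π_p` shows that `p` and its
floor have the same such `f`, so their comprehension maps factor through each other
(`comp_floor_compl_iff`). The floor is an image, hence sharp, and at sharp predicates the inverse of
`θ` splits `π`; so every comprehension map is a split mono.

Comprehension maps are thereby characterised without choosing a predicate, as the split monos `f`
through which every map killing `(img f)ᶜ` factors (`comprehensionMaps_iff`). This class is visibly
closed under composition, which gives the factorisation system.

The order hypothesis enters chiefly through `floor_eq`: sharp predicates are their own floors. Floor
and ceiling, the cokernel and the adjunction follow by rewriting. Meets are images of iterated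
comprehensions. For orthomodularity, the difference `d` between `y` and `x ∨ (xᶜ ∧ y)` has its
ceiling below `xᶜ ∧ y`, so sharpness forces `d = 0`. -/

namespace EffectusTheory

/-! ### Order, substitution and sharpness of predicates. -/

section

variable {C : Type u} [Category.{v} C] [HasFiniteCoproducts C] [Effectus C]

theorem compl_compl_pred {X : C} (p : Pred X) : pᶜᶜ = p := EffectAlgebra.compl_compl' p

theorem compl_le_compl_pred {X : C} {p q : Pred X} (h : p ≤ q) : qᶜ ≤ pᶜ :=
  EffectAlgebra.compl_le_compl' h

theorem le_compl_comm_pred {X : C} {p q : Pred X} (h : p ≤ qᶜ) : q ≤ pᶜ := by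
  have := compl_le_compl_pred h
  rwa [compl_compl_pred] at this

theorem compl_le_comm_pred {X : C} {p q : Pred X} (h : pᶜ ≤ q) : qᶜ ≤ p := by
  have := compl_le_compl_pred h
  rwa [compl_compl_pred] at this

theorem zero_le_pred {X : C} (p : Pred X) : (0 : Pred X) ≤ p := EffectAlgebra.zero_le' p

theorem le_truth {X : C} (p : Pred X) : p ≤ truth X := EffectAlgebra.le_one' p

theorem compl_truth (X : C) : (truth X)ᶜ = (0 : Pred X) := compl_compl_pred _

theorem compl_eq_truth_iff {X : C} {p : Pred X} : pᶜ = truth X ↔ p = 0 := by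
  constructor
  · intro h
    rw [← compl_compl_pred p, h, compl_truth]
  · rintro rfl
    rfl

theorem comp_le_comp {X Y : C} (f : X ⟶ Y) {p q : Pred Y} (h : p ≤ q) : f ≫ p ≤ f ≫ q := by
  obtain ⟨r, hr⟩ := h
  exact ⟨f ≫ r, FinPAC.comp_ovee f hr⟩

theorem comp_eq_zero_of_le {X Y : C} {f : X ⟶ Y} {p q : Pred Y} (h : p ≤ q) (hq : f ≫ q = 0) :
    f ≫ p = 0 :=
  le_antisymm ((comp_le_comp f h).trans hq.le) (zero_le_pred _)

/-- The condition `f^□(q) = 1`, expressed by substitution. -/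
theorem box_eq_truth_iff {X Y : C} (f : X ⟶ Y) (q : Pred Y) :
    box f q = truth X ↔ f ≫ qᶜ = 0 :=
  compl_eq_truth_iff

theorem truth_le_box_iff {X Y : C} (f : X ⟶ Y) (q : Pred Y) :
    truth X ≤ box f q ↔ f ≫ qᶜ = 0 := by
  rw [← box_eq_truth_iff]
  exact ⟨fun h => le_antisymm (le_truth _) h, fun h => h.ge⟩

/-- For total `f` the sum of `f ≫ p` and `f ≫ pᶜ` is truth, so one is truth exactly when the other
vanishes. -/
theorem IsTotalMap.comp_eq_truth_iff {X Y : C} {f : X ⟶ Y} (hf : IsTotalMap f) (p : Pred Y) :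
    f ≫ p = truth X ↔ f ≫ pᶜ = 0 := by
  have h := FinPAC.comp_ovee f (EffectAlgebra.ovee_compl p)
  change _ = some (f ≫ truth Y) at h
  rw [hf] at h
  constructor
  · intro hp
    rw [hp, PCM.ovee_comm] at h
    exact EffectAlgebra.eq_zero_of_orth_one _ ⟨_, h⟩
  · intro hp
    rw [hp, PCM.ovee_zero] at h
    exact Option.some.inj h

theorem isSharp_zero (X : C) : IsSharp (0 : Pred X) :=
  fun _ h _ => le_antisymm h (zero_le_pred _)

theorem isSharp_truth (X : C) : IsSharp (truth X) := (isSharp_zero X).compl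

theorem shaCompl_shaCompl {X : C} (p : ShaPred X) : shaCompl (shaCompl p) = p :=
  Subtype.ext (compl_compl_pred _)

theorem shaCompl_anti {X : C} {p q : ShaPred X} (h : p ≤ q) : shaCompl q ≤ shaCompl p :=
  compl_le_compl_pred (p := p.1) (q := q.1) h

theorem shaCompl_le_comm {X : C} {p q : ShaPred X} (h : shaCompl p ≤ q) : shaCompl q ≤ p :=
  compl_le_comm_pred (p := p.1) (q := q.1) h

theorem le_shaCompl_comm {X : C} {p q : ShaPred X} (h : p ≤ shaCompl q) : q ≤ shaCompl p :=
  le_compl_comm_pred (p := p.1) (q := q.1) h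

theorem isLUB_shaCompl_of_isGLB {X : C} {p q m : ShaPred X}
    (h : IsGLB {shaCompl p, shaCompl q} m) : IsLUB {p, q} (shaCompl m) := by
  refine ⟨?_, fun u hu => shaCompl_le_comm (h.2 ?_)⟩
  · rintro _ (rfl | rfl)
    · exact le_shaCompl_comm (h.1 (by simp))
    · exact le_shaCompl_comm (h.1 (by simp))
  · rintro _ (rfl | rfl)
    · exact shaCompl_anti (hu (by simp))
    · exact shaCompl_anti (hu (by simp))

theorem isGLB_shaCompl_of_isLeast {X : C} (p b : ShaPred X) (hb : IsLeast Set.univ b) :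
    IsGLB {p, shaCompl p} b := by
  refine ⟨fun _ _ => hb.2 trivial, fun t ht => ?_⟩
  have h : t.1 = 0 := p.2 t.1 (ht (Set.mem_insert _ _)) (ht (Set.mem_insert_of_mem _ rfl))
  change t.1 ≤ b.1
  rw [h]
  exact zero_le_pred _

end

/-! ### Universal properties of comprehension and quotients. -/

namespace Comprehension

variable {C : Type u} [Category.{v} C] [HasFiniteCoproducts C] [Effectus C] (K : Comprehension C)

theorem π_comp_compl {X : C} (p : Pred X) : K.π p ≫ pᶜ = 0 :=
  (truth_le_box_iff _ _).1 (K.adj.counit.app ⟨X, p⟩).2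

theorem exists_lift {X Y : C} {p : Pred X} {f : Y ⟶ X} (hf : f ≫ pᶜ = 0) :
    ∃ l : Y ⟶ K.obj p, l ≫ K.π p = f := by
  let f' : (truthFunctor C).obj Y ⟶ (⟨X, p⟩ : PredBox C) := ⟨f, (truth_le_box_iff f p).2 hf⟩
  refine ⟨K.adj.homEquiv Y ⟨X, p⟩ f', ?_⟩
  have h := (K.adj.homEquiv Y ⟨X, p⟩).symm_apply_apply f'
  rw [Adjunction.homEquiv_counit] at h
  exact congrArg Subtype.val h

instance mono_π {X : C} (p : Pred X) : Mono (K.π p) where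
  right_cancellation {Y} g h hgh := by
    apply (K.adj.homEquiv Y ⟨X, p⟩).symm.injective
    rw [Adjunction.homEquiv_counit, Adjunction.homEquiv_counit]
    exact Subtype.ext hgh

end Comprehension

namespace Quotients

variable {C : Type u} [Category.{v} C] [HasFiniteCoproducts C] [Effectus C] (Q : Quotients C)

theorem le_box_falsity_iff {X Y : C} (f : X ⟶ Y) (p : Pred X) :
    p ≤ box f (falsity Y) ↔ f ≫ truth Y ≤ pᶜ :=
  ⟨le_compl_comm_pred, le_compl_comm_pred⟩

theorem ξ_comp_truth_le {X : C} (p : Pred X) : Q.ξ p ≫ truth (Q.obj p) ≤ pᶜ :=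
  (le_box_falsity_iff _ _).1 (Q.adj.unit.app ⟨X, p⟩).2

theorem exists_desc {X Y : C} {p : Pred X} {f : X ⟶ Y} (hf : f ≫ truth Y ≤ pᶜ) :
    ∃ l : Q.obj p ⟶ Y, Q.ξ p ≫ l = f := by
  let f' : (⟨X, p⟩ : PredBox C) ⟶ (falsityFunctor C).obj Y := ⟨f, (le_box_falsity_iff f p).2 hf⟩
  refine ⟨(Q.adj.homEquiv ⟨X, p⟩ Y).symm f', ?_⟩
  have h := (Q.adj.homEquiv ⟨X, p⟩ Y).apply_symm_apply f'
  rw [Adjunction.homEquiv_unit] at h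
  exact congrArg Subtype.val h

instance epi_ξ {X : C} (p : Pred X) : Epi (Q.ξ p) where
  left_cancellation {Y} g h hgh := by
    apply (Q.adj.homEquiv ⟨X, p⟩ Y).injective
    rw [Adjunction.homEquiv_unit, Adjunction.homEquiv_unit]
    exact Subtype.ext hgh

end Quotients

/-! ### Images and internal epis. -/

section Images

variable {C : Type u} [Category.{v} C] [HasFiniteCoproducts C] [Effectus C] [HasImagePredicates C]

theorem comp_img_compl {X Y : C} (f : X ⟶ Y) : f ≫ (img f)ᶜ = 0 :=
  (box_eq_truth_iff _ _).1 (HasImagePredicates.exists_image f).choose_spec.1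

theorem img_le_iff {X Y : C} (f : X ⟶ Y) (q : Pred Y) : img f ≤ q ↔ f ≫ qᶜ = 0 :=
  ⟨fun h => comp_eq_zero_of_le (compl_le_compl_pred h) (comp_img_compl f), fun h =>
    (HasImagePredicates.exists_image f).choose_spec.2 ((box_eq_truth_iff f q).2 h)⟩

theorem img_comp_le {X Y Z : C} (f : X ⟶ Y) (g : Y ⟶ Z) : img (f ≫ g) ≤ img g := by
  rw [img_le_iff, Category.assoc, comp_img_compl, FinPAC.comp_zero]

theorem img_comp_of_epi {X Y Z : C} (f : X ⟶ Y) (g : Y ⟶ Z) [Epi f] : img (f ≫ g) = img g := by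
  refine le_antisymm (img_comp_le f g) ?_
  have h := comp_img_compl (f ≫ g)
  rw [Category.assoc, ← FinPAC.comp_zero f, cancel_epi] at h
  exact (img_le_iff _ _).2 h

theorem internalEpis_iff {X Y : C} (f : X ⟶ Y) :
    internalEpis C f ↔ ∀ p : Pred Y, f ≫ p = 0 → p = 0 := by
  constructor
  · intro h p hp
    have hf : img f = truth Y := h
    rw [← compl_compl_pred p, ← img_le_iff, hf] at hp
    exact compl_eq_truth_iff.1 (le_antisymm (le_truth _) hp)
  · intro h
    have := compl_eq_truth_iff.2 (h _ (comp_img_compl f))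
    rwa [compl_compl_pred] at this

end Images

/-! ### Assert maps, floors and split embeddings. -/

namespace QuotientsAndComprehension

variable {C : Type u} [Category.{v} C] [HasFiniteCoproducts C] [Effectus C]
variable {S : QuotientsAndComprehension C}

/-- For sharp `p`, the comprehension map `π_p` is split by `θ_p⁻¹ ∘ ξ_{pᗮ}`. -/
theorem exists_retraction_of_isSharp (S : QuotientsAndComprehension C) {X : C} {p : Pred X}
    (hp : IsSharp p) : ∃ r : X ⟶ S.cmpr p, S.π p ≫ r = 𝟙 _ := by
  have := S.isIso_theta p hp
  refine ⟨S.ξ pᶜ ≫ inv (theta S.K S.Q p), ?_⟩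
  rw [← Category.assoc]
  exact IsIso.hom_inv_id (theta S.K S.Q p)

/-- The map `asrt_p` is `π_p` preceded by an epi, namely `ξ` at `pᶜ` followed by the inverse of
`θ_p`. -/
theorem asrt_comp_eq_zero_iff (S : QuotientsAndComprehension C) {X Y : C} {p : Pred X}
    (hp : IsSharp p) (f : X ⟶ Y) : S.asrt p hp ≫ f = 0 ↔ S.π p ≫ f = 0 := by
  have := S.isIso_theta p hp
  rw [← FinPAC.comp_zero (S.ξ pᶜ ≫ inv (theta S.K S.Q p)),
    ← cancel_epi (S.ξ pᶜ ≫ inv (theta S.K S.Q p))]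
  simp [asrt]

theorem π_comp_ξ (S : QuotientsAndComprehension C) {X : C} (p : Pred X) : S.π p ≫ S.ξ p = 0 := by
  apply Effectus.eq_zero_of_truth_eq_zero
  rw [Category.assoc]
  exact comp_eq_zero_of_le (S.Q.ξ_comp_truth_le p) (S.K.π_comp_compl p)

section HasImagePredicates

variable [HasImagePredicates C]

theorem img_asrt (S : QuotientsAndComprehension C) {X : C} {p : Pred X} (hp : IsSharp p) :
    img (S.asrt p hp) = S.floor p := by
  have := S.isIso_theta p hp
  rw [asrt, img_comp_of_epi, img_comp_of_epi, floor]

theorem floor_le (S : QuotientsAndComprehension C) {X : C} (p : Pred X) : S.floor p ≤ p :=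
  (img_le_iff _ _).2 (S.K.π_comp_compl p)

/-- If `f` kills `pᶜ`, it factors through `π_p`, so its image lies below that of `π_p`, which is the
floor. -/
theorem comp_floor_compl_iff (S : QuotientsAndComprehension C) {X Y : C} (f : Y ⟶ X)
    (p : Pred X) : f ≫ (S.floor p)ᶜ = 0 ↔ f ≫ pᶜ = 0 := by
  constructor
  · exact comp_eq_zero_of_le (compl_le_compl_pred (S.floor_le p))
  · intro h
    obtain ⟨l, rfl⟩ := S.K.exists_lift h
    rw [← img_le_iff]
    exact img_comp_le _ _

/-- Split monomorphisms through which each map factors that their image allows; these turn out to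
be the comprehension maps. -/
structure IsSplitEmbedding {X Y : C} (f : X ⟶ Y) : Prop where
  exists_retraction : ∃ r : Y ⟶ X, f ≫ r = 𝟙 X
  exists_lift : ∀ {Z : C} (k : Z ⟶ Y), k ≫ (img f)ᶜ = 0 → ∃ l : Z ⟶ X, l ≫ f = k

theorem IsSplitEmbedding.mono {X Y : C} {f : X ⟶ Y} (hf : IsSplitEmbedding f) : Mono f := by
  obtain ⟨r, hr⟩ := hf.exists_retraction
  exact (SplitMono.mk r hr).mono

theorem IsSplitEmbedding.of_isIso {X Y : C} (f : X ⟶ Y) [IsIso f] : IsSplitEmbedding f :=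
  ⟨⟨inv f, by simp⟩, fun k _ => ⟨k ≫ inv f, by simp⟩⟩

theorem IsSplitEmbedding.comp {X Y Z : C} {f : X ⟶ Y} {g : Y ⟶ Z} (hf : IsSplitEmbedding f)
    (hg : IsSplitEmbedding g) : IsSplitEmbedding (f ≫ g) := by
  obtain ⟨r, hr⟩ := hf.exists_retraction
  obtain ⟨t, ht⟩ := hg.exists_retraction
  refine ⟨⟨t ≫ r, by rw [Category.assoc, reassoc_of% ht, hr]⟩, fun k hk => ?_⟩
  obtain ⟨h, rfl⟩ := hg.exists_lift k
    (comp_eq_zero_of_le (compl_le_compl_pred (img_comp_le f g)) hk)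
  -- The retraction `t` of `g` pulls `(img f)ᶜ` back to a predicate killed by `f ≫ g`. The map `h ≫
  -- g` therefore kills it as well, and `g ≫ t = 𝟙` turns this into `h ≫ (img f)ᶜ = 0`.
  have hle : img (f ≫ g) ≤ (t ≫ (img f)ᶜ)ᶜ := by
    rw [img_le_iff, compl_compl_pred, Category.assoc, reassoc_of% ht, comp_img_compl]
  have hz := comp_eq_zero_of_le (le_compl_comm_pred hle) hk
  rw [Category.assoc, reassoc_of% ht] at hz
  obtain ⟨l, rfl⟩ := hf.exists_lift h hz
  exact ⟨l, (Category.assoc _ _ _).symm⟩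

theorem IsSplitEmbedding.exists_iso (S : QuotientsAndComprehension C) {X Y : C} {f : X ⟶ Y}
    (hf : IsSplitEmbedding f) : ∃ e : X ≅ S.cmpr (img f), e.hom ≫ S.π (img f) = f := by
  have := hf.mono
  obtain ⟨i, hi⟩ := S.K.exists_lift (comp_img_compl f)
  obtain ⟨j, hj⟩ := hf.exists_lift _ (S.K.π_comp_compl (img f))
  refine ⟨⟨i, j, ?_, ?_⟩, hi⟩
  · rw [← cancel_mono f, Category.assoc, hj, hi, Category.id_comp]
  · rw [← cancel_mono (S.K.π (img f)), Category.assoc, hi, hj, Category.id_comp]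

theorem IsSplitEmbedding.isIso {X Y : C} {f : X ⟶ Y} (hf : IsSplitEmbedding f)
    (he : internalEpis C f) : IsIso f := by
  have := hf.mono
  have he : img f = truth Y := he
  obtain ⟨l, hl⟩ := hf.exists_lift (𝟙 Y) (by rw [he, compl_truth, FinPAC.comp_zero])
  exact ⟨l, by rw [← cancel_mono f, Category.assoc, hl, Category.comp_id, Category.id_comp], hl⟩

end HasImagePredicates

/-! ### Sharp images: the factorisation system, floors and the orthomodular lattice. -/

section HasSharpImages

variable [HasSharpImages C]

theorem isSharp_floor (S : QuotientsAndComprehension C) {X : C} (p : Pred X) :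
    IsSharp (S.floor p) :=
  HasSharpImages.sharp_img _

/-- Here `p` need not be sharp, so `θ_p` need not be invertible. The retraction exists at the sharp
floor and is transported along the mutual factorisations of the two comprehension maps. -/
theorem isSplitEmbedding_π (S : QuotientsAndComprehension C) {X : C} (p : Pred X) :
    IsSplitEmbedding (S.π p) := by
  refine ⟨?_, fun k hk => S.K.exists_lift ((S.comp_floor_compl_iff k p).1 hk)⟩
  obtain ⟨r, hr⟩ := S.exists_retraction_of_isSharp (S.isSharp_floor p)
  obtain ⟨i, hi⟩ := S.K.exists_lift ((S.comp_floor_compl_iff _ p).2 (S.K.π_comp_compl p))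
  obtain ⟨j, hj⟩ := S.K.exists_lift ((S.comp_floor_compl_iff _ p).1
    (S.K.π_comp_compl (S.floor p)))
  refine ⟨r ≫ j, ?_⟩
  change S.K.π p ≫ r ≫ j = _
  rw [← cancel_mono (S.K.π p), Category.assoc, Category.assoc, hj, Category.id_comp, ← hi,
    Category.assoc, reassoc_of% hr]

theorem comprehensionMaps_iff (S : QuotientsAndComprehension C) {X Y : C} (f : X ⟶ Y) :
    S.comprehensionMaps f ↔ IsSplitEmbedding f := by
  constructor
  · rintro ⟨p, e, rfl⟩
    exact (IsSplitEmbedding.of_isIso e.hom).comp (S.isSplitEmbedding_π p)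
  · intro h
    exact ⟨_, h.exists_iso S⟩

theorem isFactorisationSystem (S : QuotientsAndComprehension C) :
    IsFactorisationSystem (internalEpis C) S.comprehensionMaps where
  iso_left f _ := by
    rw [internalEpis_iff]
    intro p hp
    rwa [← FinPAC.comp_zero f, cancel_epi] at hp
  iso_right f _ := (S.comprehensionMaps_iff f).2 (.of_isIso f)
  comp_left f g hf hg := by
    rw [internalEpis_iff] at hf hg ⊢
    intro p hp
    rw [Category.assoc] at hp
    exact hg p (hf _ hp)
  comp_right f g hf hg := by
    rw [comprehensionMaps_iff] at hf hg ⊢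
    exact hf.comp hg
  isIso_of_both f he hm := ((S.comprehensionMaps_iff f).1 hm).isIso he
  factor {X Y} f := by
    obtain ⟨e, he⟩ := S.K.exists_lift (comp_img_compl f)
    refine ⟨_, e, S.π (img f), ?_, (S.comprehensionMaps_iff _).2 (S.isSplitEmbedding_π _), he⟩
    rw [internalEpis_iff]
    intro p hp
    rw [← compl_compl_pred p] at hp
    obtain ⟨k, hk⟩ := S.K.exists_lift hp
    -- If the first factor `e` kills `p`, then `f` factors through the composite `π_{pᶜ} ≫ π_{im
    -- f}`. By minimality of the image, `π_{im f}` factors through it too, so `π_{pᶜ}` has a section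
    -- and `p = 0`.
    have hle : img f ≤ img (S.π pᶜ ≫ S.π (img f)) := by
      conv_lhs => rw [← he, ← hk, Category.assoc]
      exact img_comp_le _ _
    obtain ⟨l, hl⟩ := ((S.isSplitEmbedding_π pᶜ).comp
      (S.isSplitEmbedding_π (img f))).exists_lift (S.π (img f))
        (comp_eq_zero_of_le (compl_le_compl_pred hle) (S.K.π_comp_compl _))
    have hid : l ≫ S.K.π pᶜ = 𝟙 _ := by
      rw [← cancel_mono (S.K.π (img f)), Category.assoc, hl, Category.id_comp]
    have hz := S.K.π_comp_compl pᶜ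
    rw [compl_compl_pred] at hz
    rw [← Category.id_comp p, ← hid, Category.assoc, hz, FinPAC.comp_zero]
  fill_in e m g h he hm hsq := by
    rw [comprehensionMaps_iff] at hm
    rw [internalEpis_iff] at he
    have := hm.mono
    -- An internal epi reflects vanishing of predicates: `h` kills `(img m)ᶜ` because `e ≫ h = g ≫
    -- m` does.
    obtain ⟨d, rfl⟩ := hm.exists_lift h (he _ (by
      rw [reassoc_of% hsq, comp_img_compl, FinPAC.comp_zero]))
    refine ⟨d, ⟨?_, rfl⟩, fun d' hd' => (cancel_mono m).1 hd'.2⟩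
    rw [← cancel_mono m, Category.assoc, hsq]

theorem floor_eq (hS : S.OrderByFactorisation) {X : C} {p : Pred X} (hp : IsSharp p) :
    S.floor p = p := by
  refine le_antisymm (S.floor_le p) ((hS _ _ hp (S.isSharp_floor p)).2 ?_)
  exact S.K.exists_lift (comp_img_compl (S.π p))

theorem isGreatest_floor (hS : S.OrderByFactorisation) {X : C} (p : Pred X) :
    IsGreatest {s : Pred X | IsSharp s ∧ s ≤ p} (S.floor p) := by
  refine ⟨⟨S.isSharp_floor p, S.floor_le p⟩, ?_⟩
  rintro s ⟨hs, hsp⟩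
  rw [← floor_eq hS hs]
  refine (img_le_iff _ _).2 ((S.comp_floor_compl_iff _ _).2 ?_)
  exact comp_eq_zero_of_le (compl_le_compl_pred hsp) (S.K.π_comp_compl s)

theorem isLeast_ceil (hS : S.OrderByFactorisation) {X : C} (p : Pred X) :
    IsLeast {s : Pred X | IsSharp s ∧ p ≤ s} (S.ceil p) := by
  refine ⟨⟨(S.isSharp_floor _).compl, le_compl_comm_pred (S.floor_le _)⟩, ?_⟩
  rintro s ⟨hs, hps⟩
  exact compl_le_comm_pred ((isGreatest_floor hS pᶜ).2 ⟨hs.compl, compl_le_compl_pred hps⟩)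

/-- For sharp `p`, the quotient map `ξ_p` is a cokernel of `asrt_p`. -/
theorem nonempty_isColimit_cofork_asrt (hS : S.OrderByFactorisation) {X : C} {p : Pred X}
    (hp : IsSharp p) (w : S.asrt p hp ≫ S.ξ p = 0 ≫ S.ξ p) :
    Nonempty (IsColimit (Cofork.ofπ (S.ξ p) w)) := by
  have key : ∀ {Y : C} (f : X ⟶ Y), S.asrt p hp ≫ f = 0 ≫ f →
      ∃ l : S.quot p ⟶ Y, S.ξ p ≫ l = f := by
    intro Y f hf
    rw [FinPAC.zero_comp, asrt_comp_eq_zero_iff] at hf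
    apply S.Q.exists_desc
    apply le_compl_comm_pred
    -- Replacing `p` by its floor, an image, turns the inequality `p ≤ (f ≫ 1)ᶜ` into the equation
    -- `π_p ≫ f ≫ 1 = 0`.
    conv_lhs => rw [← floor_eq hS hp]
    refine (img_le_iff _ _).2 ?_
    rw [compl_compl_pred, ← Category.assoc, hf, FinPAC.zero_comp]
  refine ⟨Cofork.IsColimit.mk' _ fun s => ?_⟩
  refine ⟨(key s.π s.condition).choose, (key s.π s.condition).choose_spec, fun {m} hm => ?_⟩
  exact (cancel_epi (S.Q.ξ p)).1 (hm.trans (key s.π s.condition).choose_spec.symm)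

/-- Both inequalities unfold to `π_p ≫ f ≫ qᶜ = 0`. -/
theorem gc_shaSigma_shaBox (hS : S.OrderByFactorisation) {X Y : C} (f : X ⟶ Y) :
    GaloisConnection (S.shaSigma f) (S.shaBox f) := by
  rintro ⟨p, hp⟩ ⟨q, hq⟩
  change img (S.π p ≫ f) ≤ q ↔ p ≤ S.floor (box f q)
  rw [img_le_iff, Category.assoc]
  conv_rhs => rw [← floor_eq hS hp]
  rw [floor, img_le_iff, comp_floor_compl_iff, box, compl_compl_pred]

/-- The meet restricts `q` to `{X | p}`, comprehends there, and takes the image in `X`. A sharp `t`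
below both has `π_t` factoring through this composite. -/
theorem exists_isGLB_shaPred (hS : S.OrderByFactorisation) {X : C} (p q : ShaPred X) :
    ∃ m, IsGLB {p, q} m := by
  let c := S.π (box (S.π p.1) q.1) ≫ S.π p.1
  refine ⟨⟨img c, HasSharpImages.sharp_img _⟩, ?_, ?_⟩
  · rintro z (hz | hz) <;> obtain rfl : _ = z := hz.symm
    · exact (img_comp_le _ _).trans (S.floor_le _)
    · refine (img_le_iff _ _).2 ?_
      have h := S.K.π_comp_compl (box (S.π p.1) q.1)
      rw [box, compl_compl_pred] at h
      exact (Category.assoc _ _ _).trans h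
  · rintro ⟨t, ht⟩ hlb
    have htp : t ≤ p.1 := hlb (Set.mem_insert _ _)
    have htq : t ≤ q.1 := hlb (Set.mem_insert_of_mem _ rfl)
    change t ≤ img c
    obtain ⟨h, hh⟩ := (hS _ _ ht p.2).1 htp
    obtain ⟨k, hk⟩ := S.K.exists_lift (p := box (S.π p.1) q.1) (f := h) (by
      rw [box, compl_compl_pred, ← Category.assoc, hh]
      exact comp_eq_zero_of_le (compl_le_compl_pred htq) (S.K.π_comp_compl t))
    rw [← floor_eq hS ht, floor, ← hh, ← hk, Category.assoc]
    exact img_comp_le _ _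

theorem isOrthomodularLattice_shaPred (hS : S.OrderByFactorisation) (X : C) :
    IsOrthomodularLattice (ShaPred X) shaCompl := by
  have hsup : ∀ x y : ShaPred X, ∃ j, IsLUB {x, y} j := fun x y =>
    (exists_isGLB_shaPred hS (shaCompl x) (shaCompl y)).imp' _ fun _ h =>
      isLUB_shaCompl_of_isGLB h
  refine ⟨⟨⟨0, isSharp_zero X⟩, trivial, fun t _ => zero_le_pred t.1⟩,
    ⟨⟨truth X, isSharp_truth X⟩, trivial, fun t _ => le_truth t.1⟩,
    exists_isGLB_shaPred hS, hsup, shaCompl_shaCompl, fun _ _ => shaCompl_anti,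
    isGLB_shaCompl_of_isLeast, ?_, ?_⟩
  · intro x t ht
    have hb : IsLeast Set.univ (shaCompl t) :=
      ⟨trivial, fun u _ => shaCompl_le_comm (ht.2 trivial)⟩
    have h := isLUB_shaCompl_of_isGLB (p := x) (q := shaCompl x)
      (by rw [Set.pair_comm, shaCompl_shaCompl]; exact isGLB_shaCompl_of_isLeast x _ hb)
    rwa [shaCompl_shaCompl] at h
  · intro x y m hxy hm
    obtain ⟨j, hj⟩ := hsup x m
    have hjy : j ≤ y := by
      refine hj.2 ?_
      rintro _ (rfl | rfl)
      · exact hxy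
      · exact hm.1 (by simp)
    -- The defect `d` of `j = x ∨ m` in `y` is only a predicate; its ceiling is sharp and can be
    -- compared with the meet `m`. This puts `d` below both `j` and `jᶜ`.
    obtain ⟨d, hd⟩ : ∃ d, PCM.ovee j.1 d = some y.1 := hjy
    have hdy : d ≤ y.1 := ⟨j.1, by rw [PCM.ovee_comm]; exact hd⟩
    have hdj : d ≤ j.1ᶜ := by
      obtain ⟨r, hr, hjr⟩ := PCM.ovee_assoc hd (EffectAlgebra.ovee_compl y.1)
      exact ⟨_, hr.trans (congrArg some (EffectAlgebra.compl_unique _ _ hjr))⟩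
    have hdx : d ≤ x.1ᶜ := hdj.trans (shaCompl_anti (hj.1 (by simp) : x ≤ j))
    let D : ShaPred X := ⟨S.ceil d, (isLeast_ceil hS d).1.1⟩
    have hDm : D ≤ m := by
      refine hm.2 ?_
      rintro z (hz | hz) <;> obtain rfl : _ = z := hz.symm
      · exact (isLeast_ceil hS d).2 ⟨x.2.compl, hdx⟩
      · exact (isLeast_ceil hS d).2 ⟨y.2, hdy⟩
    have hDj : D ≤ j := hDm.trans (hj.1 (by simp))
    have hd0 : d = 0 := j.2 d ((isLeast_ceil hS d).1.2.trans hDj) hdj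
    rw [hd0, PCM.ovee_zero] at hd
    rwa [← Subtype.ext (Option.some.inj hd)]

end HasSharpImages

end QuotientsAndComprehension

end EffectusTheory

theorem mainTheorem9 {C : Type u} [Category.{v} C] [HasFiniteCoproducts C] [Effectus C]
    (S : QuotientsAndComprehension C) [HasSharpImages C] (hS : S.OrderByFactorisation) :
    -- floor and ceiling
    (∀ {X : C} (p : Pred X),
      IsGreatest {s : Pred X | IsSharp s ∧ s ≤ p} (S.floor p) ∧
      IsLeast {s : Pred X | IsSharp s ∧ p ≤ s} (S.ceil p)) ∧
    -- substitution into floor and ceiling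
    (∀ {X Y : C} (p : Pred X),
      (∀ f : Y ⟶ X, IsTotalMap f →
        (f ≫ p = truth Y ↔ f ≫ S.floor p = truth Y) ∧
        (f ≫ p = falsity Y ↔ f ≫ S.ceil p = falsity Y)) ∧
      (∀ g : Y ⟶ X, box g p = truth Y ↔ box g (S.floor p) = truth Y)) ∧
    -- the image and the cokernel map of an assert map
    (∀ {X : C} (p : Pred X) (hp : IsSharp p),
      img (S.asrt p hp) = p ∧
      ∃ w : S.asrt p hp ≫ S.ξ p = 0 ≫ S.ξ p, Nonempty (IsColimit (Cofork.ofπ (S.ξ p) w))) ∧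
    -- the adjunction between sharp predicates
    (∀ {X Y : C} (f : X ⟶ Y), GaloisConnection (S.shaSigma f) (S.shaBox f)) ∧
    -- comprehension maps are closed under composition, up to isomorphism
    (∀ {X : C} (p : Pred X) (q : Pred (S.cmpr p)),
      ∃ e : S.cmpr q ≅ S.cmpr (S.sigma (S.π p) q),
        e.hom ≫ S.π (S.sigma (S.π p) q) = S.π q ≫ S.π p) ∧
    -- sharp predicates form orthomodular lattices
    (∀ X : C, IsOrthomodularLattice (ShaPred X) shaCompl) ∧
    -- internal epis and comprehension maps form a factorisation system
    IsFactorisationSystem (internalEpis C) S.comprehensionMaps := by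
  open QuotientsAndComprehension in
  refine ⟨fun p => ⟨isGreatest_floor hS p, isLeast_ceil hS p⟩, ?_, ?_,
    fun f => gc_shaSigma_shaBox hS f, fun p q =>
      ((S.isSplitEmbedding_π q).comp (S.isSplitEmbedding_π p)).exists_iso S,
    fun X => isOrthomodularLattice_shaPred hS X, S.isFactorisationSystem⟩
  · intro X Y p
    refine ⟨fun f hf => ⟨?_, ?_⟩, fun g => ?_⟩
    · rw [hf.comp_eq_truth_iff, hf.comp_eq_truth_iff, S.comp_floor_compl_iff]
    · rw [falsity, ceil, S.comp_floor_compl_iff, compl_compl_pred]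
    · rw [box_eq_truth_iff, box_eq_truth_iff, S.comp_floor_compl_iff]
  · intro X p hp
    have w : S.asrt p hp ≫ S.ξ p = 0 ≫ S.ξ p := by
      rw [FinPAC.zero_comp, S.asrt_comp_eq_zero_iff, S.π_comp_ξ]
    exact ⟨(S.img_asrt hp).trans (floor_eq hS hp), w, nonempty_isColimit_cofork_asrt hS hp w⟩
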